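/- Let $\mathbb{T}=\mathbb{R}\cup\{-\infty\}$ be the tropical semifield (addition is $\max$, multiplication is $+$), write $t^a\in\mathbb{T}$ for the element corresponding to $a\in\mathbb{R}$, let $S\subseteq\mathbb{T}$ be a sub-semifield, and let $\Gamma=\log(S^\times)=\{\gamma\in\mathbb{R} : t^\gamma\in S\}$. Let $M$ be a finitely generated free abelian group, $N_{\mathbb{R}}=\operatorname{Hom}(M,\mathbb{R})$, and let $S[M]$ be the monoid semialgebra, with terms $a\chi^u$ ($a\in S$, $u\in M$). For $w=(r,\xi)\in\mathbb{R}_{\ge0}\times N_{\mathbb{R}}$ and $(\gamma,u)\in\mathbb{R}\times M$ put $\langle w,(\gamma,u)\rangle=r\gamma+\langle\xi,u\rangle$. *Flags.* A cone is a strongly convex (i.e. containing no line) polyhedral cone, not necessarily rational. A flag of cones $\mathcal{C}_\bullet=(\mathcal{C}_0\le\cdots\le\mathcal{C}_k)$, $k\ge 0$, consists of cones $\mathcal{C}_i\subseteq\mathbb{R}_{\ge0}\times N_{\mathbb{R}}$ with $\dim\mathcal{C}_i=i+1$ and $\mathcal{C}_{i-1}$ a face of $\mathcal{C}_i$; it is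 simplicial if every $\mathcal{C}_i$ is a simplicial cone. A flag of polyhedra $\mathcal{P}_\bullet=(\mathcal{P}_0\le\cdots\le\mathcal{P}_k)$, $k\ge 0$, consists of non-empty polyhedra $\mathcal{P}_i\subseteq N_{\mathbb{R}}$ containing no line, with $\dim\mathcal{P}_i=i$ and $\mathcal{P}_{i-1}$ a face of $\mathcal{P}_i$. Its flag of cones is $c(\mathcal{P}_\bullet)=(c(\mathcal{P}_0)\le\cdots\le c(\mathcal{P}_k))$, where $c(\mathcal{P})\subseteq\mathbb{R}_{\ge0}\times N_{\mathbb{R}}$ is the closed cone generated by $\{1\}\times\mathcal{P}$. *Prime congruences.* Given a flag of cones $\mathcal{C}_\bullet$, put $\mathcal{C}_{-1}=\{0\}$ and choose $w_i\in\mathcal{C}_i\setminus\mathcal{C}_{i-1}$ for $0\le i\le k$. The prime congruence $P_{\mathcal{C}_\bullet}$ on $S[M]$ is the kernel $\{(f,g) : \varphi(f)=\varphi(g)\}$ of the semiring homomorphism $\varphi:S[M]\to\mathbb{R}^{k+1}_{\mathrm{lex}}\cup\{-\infty\}$ (addition is the lexicographic maximum, multiplication is vector addition) with $\varphi(a\chi^u)=\big(\langle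 w_0,(\log a,u)\rangle,\ldots,\langle w_k,(\log a,u)\rangle\big)$ for $a\ne 0_S$; it does not depend on the choice of the $w_i$. For a flag of polyhedra put $P_{\mathcal{P}_\bullet}=P_{c(\mathcal{P}_\bullet)}$. *Local equivalence.* A $\Gamma$-admissible cone is a set $\{(r,x)\in\mathbb{R}_{\ge0}\times N_{\mathbb{R}} : r\gamma_i+\langle x,u_i\rangle\le0,\ i=1,\ldots,q\}$, and a $\Gamma$-rational polyhedron is a set $\{x\in N_{\mathbb{R}} : \langle x,u_i\rangle\le\gamma_i,\ i=1,\ldots,q\}$, with $u_i\in M$ and $\gamma_i\in\Gamma$. A $\Gamma$-admissible neighborhood of $\mathcal{C}_\bullet$ is a $\Gamma$-admissible cone that meets the relative interior of every $\mathcal{C}_i$; a $\Gamma$-rational neighborhood of $\mathcal{P}_\bullet$ is a $\Gamma$-rational polyhedron that meets the relative interior of every $\mathcal{P}_i$. Two flags of cones (respectively of polyhedra) are $\Gamma$-locally equivalent if they have the same $\Gamma$-admissible (respectively $\Gamma$-rational) neighborhoods. **Corollary.** (1) Let $\mathcal{C}_\bullet$ and $\mathcal{C}'_\bullet$ be simplicial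 flags of cones (possibly of different lengths). Then $P_{\mathcal{C}_\bullet}=P_{\mathcal{C}'_\bullet}$ if and only if $\mathcal{C}_\bullet$ and $\mathcal{C}'_\bullet$ are $\Gamma$-locally equivalent. (2) Let $\mathcal{P}_\bullet$ and $\mathcal{P}'_\bullet$ be flags of polyhedra (possibly of different lengths). Then $P_{\mathcal{P}_\bullet}=P_{\mathcal{P}'_\bullet}$ if and only if $\mathcal{P}_\bullet$ and $\mathcal{P}'_\bullet$ are $\Gamma$-locally equivalent. -/

import Mathlib

open Tropical

namespace FlagPrime

set_option linter.unusedSectionVars false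

noncomputable section

/-! ### Tropical semifields in the max-plus convention -/

section MaxPlus

/-- The idempotent semifield `G ∪ {-∞}` of a totally ordered abelian group `G`: addition is the
maximum, multiplication is the addition of `G`, and `-∞` is the zero element. It is the min-plus
semiring of `G` with the opposite order, so that `-∞` is `trop ⊤`. For `G = ℝ` this is the tropical
semifield `𝕋`. -/
abbrev MaxPlus (G : Type*) : Type _ := Tropical (WithTop Gᵒᵈ)

variable {G H : Type*}
  [AddCommGroup G] [LinearOrder G] [IsOrderedAddMonoid G]
  [AddCommGroup H] [LinearOrder H] [IsOrderedAddMonoid H]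

/-- The element `t^a` of `G ∪ {-∞}` that corresponds to `a ∈ G`. -/
def texp (a : G) : MaxPlus G := trop ((OrderDual.toDual a : Gᵒᵈ) : WithTop Gᵒᵈ)

/-- Sanity check: addition in `G ∪ {-∞}` is the maximum. -/
theorem texp_add_texp (a b : G) : texp a + texp b = texp (max a b) := rfl

/-- Sanity check: multiplication in `G ∪ {-∞}` is the addition of `G`. -/
theorem texp_mul_texp (a b : G) : texp a * texp b = texp (a + b) := rfl

theorem texp_zero : texp (0 : G) = 1 := rfl

theorem eq_zero_or_texp (x : MaxPlus G) : x = 0 ∨ ∃ a, x = texp a := by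
  induction x using Tropical.tropRec with
  | h x =>
    induction x using WithTop.recTopCoe with
    | top => exact Or.inl rfl
    | coe a => exact Or.inr ⟨OrderDual.ofDual a, rfl⟩

/-- A monotone group homomorphism `G → H`, extended by `-∞ ↦ -∞`, is a semiring homomorphism. -/
def MaxPlus.map (f : G →+ H) (hf : Monotone f) : MaxPlus G →+* MaxPlus H where
  toFun x := trop ((untrop x).map fun a => OrderDual.toDual (f (OrderDual.ofDual a)))
  map_one' := by
    change texp (f 0) = 1
    rw [map_zero, texp_zero]
  map_zero' := rfl
  map_mul' x y := by
    rcases eq_zero_or_texp x with rfl | ⟨a, rfl⟩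
    · rw [zero_mul]; exact (zero_mul _).symm
    rcases eq_zero_or_texp y with rfl | ⟨b, rfl⟩
    · rw [mul_zero]; exact (mul_zero _).symm
    change texp (f (a + b)) = texp (f a) * texp (f b)
    rw [texp_mul_texp, map_add]
  map_add' x y := by
    rcases eq_zero_or_texp x with rfl | ⟨a, rfl⟩
    · rw [zero_add]; exact (zero_add _).symm
    rcases eq_zero_or_texp y with rfl | ⟨b, rfl⟩
    · rw [add_zero]; exact (add_zero _).symm
    change texp (f (max a b)) = texp (f a) + texp (f b)
    rw [texp_add_texp, hf.map_max]

theorem MaxPlus.map_texp (f : G →+ H) (hf : Monotone f) (a : G) :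
    MaxPlus.map f hf (texp a) = texp (f a) := rfl

theorem texp_injective : Function.Injective (texp : G → MaxPlus G) := fun a b h => by
  simpa [texp] using h

theorem texp_ne_zero (a : G) : texp a ≠ 0 := fun h => by
  have := congrArg untrop h
  simp [texp] at this

theorem MaxPlus.map_injective (f : G →+ H) (hf : Monotone f) (hi : Function.Injective f) :
    Function.Injective (MaxPlus.map f hf) := by
  intro x y h
  rcases eq_zero_or_texp x with rfl | ⟨a, rfl⟩ <;> rcases eq_zero_or_texp y with rfl | ⟨b, rfl⟩
  · rfl
  · rw [map_zero, MaxPlus.map_texp] at h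
    exact absurd h.symm (texp_ne_zero _)
  · rw [map_zero, MaxPlus.map_texp] at h
    exact absurd h (texp_ne_zero _)
  · rw [MaxPlus.map_texp, MaxPlus.map_texp] at h
    rw [hi (texp_injective h)]

end MaxPlus

/-- A sub-semifield of `𝕋`: a subsemiring that contains the inverses of its nonzero elements. -/
def IsSubsemifield (S : Subsemiring (MaxPlus ℝ)) : Prop :=
  ∀ a ∈ S, a ≠ 0 → ∃ b ∈ S, a * b = 1

/-- The value group `Γ = log (S^×) ⊆ ℝ` of a sub-semifield `S` of `𝕋`. -/
def valueGroup (S : Subsemiring (MaxPlus ℝ)) : Set ℝ := {γ | texp γ ∈ S}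

/-! ### The space `N_ℝ = Hom(M, ℝ)` -/

/-- The real vector space `N_ℝ = Hom(M, ℝ)` of group homomorphisms `M → ℝ`. -/
abbrev NR (M : Type*) [AddCommGroup M] : Type _ := M →ₗ[ℤ] ℝ

section NR

variable {M : Type*} [AddCommGroup M]

/-- The topology of pointwise convergence, which for finitely generated `M` is the usual topology
of the finite-dimensional real vector space `N_ℝ`. -/
instance : TopologicalSpace (M →ₗ[ℤ] ℝ) := TopologicalSpace.induced (fun f => (f : M → ℝ)) inferInstance

/-- The inclusion of `N_ℝ` in the space of all functions `M → ℝ`. -/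
def coeLin (M : Type*) [AddCommGroup M] : (M →ₗ[ℤ] ℝ) →ₗ[ℝ] (M → ℝ) where
  toFun f := f
  map_add' _ _ := rfl
  map_smul' _ _ := rfl

instance : IsTopologicalAddGroup (M →ₗ[ℤ] ℝ) := topologicalAddGroup_induced (coeLin M)

instance : ContinuousSMul ℝ (M →ₗ[ℤ] ℝ) := continuousSMul_induced (coeLin M)

instance : T2Space (M →ₗ[ℤ] ℝ) :=
  T2Space.of_injective_continuous (f := fun f : M →ₗ[ℤ] ℝ => (f : M → ℝ)) DFunLike.coe_injective
    continuous_induced_dom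

instance [Module.Finite ℤ M] [Module.Free ℤ M] : Module.Finite ℝ (M →ₗ[ℤ] ℝ) := by
  let b := Module.Free.chooseBasis ℤ M
  let φ : (M →ₗ[ℤ] ℝ) →ₗ[ℝ] (Module.Free.ChooseBasisIndex ℤ M → ℝ) :=
    { toFun := fun f i => f (b i), map_add' := fun _ _ => rfl, map_smul' := fun _ _ => rfl }
  refine Module.Finite.of_injective φ fun f g h => ?_
  exact b.ext fun i => congrFun h i

end NR

/-! ### Cones and polyhedra in a real vector space -/

section Convex

variable {V : Type*} [AddCommGroup V] [Module ℝ V]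

/-- A cone in the sense used here: a strongly convex polyhedral cone, i.e. an intersection of
finitely many closed linear half-spaces that contains no line. -/
structure IsCone (C : PointedCone ℝ V) : Prop where
  polyhedral : C.DualFG (LinearMap.id : Module.Dual ℝ V →ₗ[ℝ] V →ₗ[ℝ] ℝ)
  stronglyConvex : C.lineal = ⊥

/-- The dimension of a cone is the dimension of its linear span. -/
def coneDim (C : PointedCone ℝ V) : ℕ := Module.finrank ℝ (Submodule.span ℝ (C : Set V))

/-- A non-empty strongly convex polyhedron: a non-empty intersection of finitely many closed affine
half-spaces that contains no line. -/
structure IsStronglyConvexPolyhedron (P : Set V) : Prop where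
  polyhedral : ∃ s : Finset (Module.Dual ℝ V × ℝ), P = {x | ∀ h ∈ s, h.1 x ≤ h.2}
  nonempty : P.Nonempty
  stronglyConvex : ∀ x v : V, (∀ t : ℝ, x + t • v ∈ P) → v = 0

/-- The dimension of a polyhedron is the dimension of its affine span. -/
def polyDim (P : Set V) : ℕ := Module.finrank ℝ (vectorSpan ℝ P)

theorem bot_isFaceOf {C : PointedCone ℝ V} (h : C.lineal = ⊥) :
    PointedCone.IsFaceOf (⊥ : PointedCone ℝ V) C where
  le := bot_le
  mem_of_smul_add_mem {x y a} hx hy ha hxy := by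
    rw [Submodule.mem_bot] at hxy ⊢
    have h1 : a • x ∈ C.lineal := by
      refine PointedCone.mem_lineal.2 ⟨C.smul_mem ha.le hx, ?_⟩
      rwa [neg_eq_of_add_eq_zero_right hxy]
    rw [h, Submodule.mem_bot] at h1
    exact (smul_eq_zero.1 h1).resolve_left ha.ne'

theorem mem_face_of_mem_span {F C : PointedCone ℝ V} (hF : F.IsFaceOf C) {x : V} (hx : x ∈ C)
    (hs : x ∈ Submodule.span ℝ (F : Set V)) : x ∈ F := by
  have key : ∀ y ∈ Submodule.span ℝ (F : Set V), ∃ p ∈ F, ∃ q ∈ F, y = p - q := by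
    intro y hy
    induction hy using Submodule.span_induction with
    | mem y hy => exact ⟨y, hy, 0, F.zero_mem, by simp⟩
    | zero => exact ⟨0, F.zero_mem, 0, F.zero_mem, by simp⟩
    | add y z _ _ hy hz =>
      obtain ⟨p, hp, q, hq, rfl⟩ := hy
      obtain ⟨p', hp', q', hq', rfl⟩ := hz
      exact ⟨p + p', F.add_mem hp hp', q + q', F.add_mem hq hq', by abel⟩
    | smul a y _ hy =>
      obtain ⟨p, hp, q, hq, rfl⟩ := hy
      rcases le_total 0 a with ha | ha
      · exact ⟨a • p, F.smul_mem ha hp, a • q, F.smul_mem ha hq, smul_sub _ _ _⟩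
      · refine ⟨(-a) • q, F.smul_mem (neg_nonneg.2 ha) hq, (-a) • p,
          F.smul_mem (neg_nonneg.2 ha) hp, ?_⟩
        simp only [neg_smul, smul_sub]; abel
  obtain ⟨p, hp, q, hq, rfl⟩ := key x hs
  exact hF.mem_of_smul_add_mem hx (hF.le hq) one_pos (by simpa using hp)

variable [FiniteDimensional ℝ V]

theorem span_cone_eq {F C : PointedCone ℝ V} (hF : F.IsFaceOf C)
    (hd : coneDim C = coneDim F + 1) {w : V} (hw : w ∈ C) (hw' : w ∉ F) :
    Submodule.span ℝ (C : Set V) = Submodule.span ℝ (F : Set V) ⊔ Submodule.span ℝ {w} := by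
  have hn : w ∉ Submodule.span ℝ (F : Set V) := fun h => hw' (mem_face_of_mem_span hF hw h)
  symm
  refine Submodule.eq_of_le_of_finrank_le ?_ ?_
  · refine sup_le (Submodule.span_mono hF.le) ?_
    rw [Submodule.span_singleton_le_iff_mem]
    exact Submodule.subset_span hw
  · have hlt : Submodule.span ℝ (F : Set V) <
        Submodule.span ℝ (F : Set V) ⊔ Submodule.span ℝ {w} := by
      refine lt_of_le_of_ne le_sup_left fun h => hn ?_
      rw [h]
      exact Submodule.mem_sup_right (Submodule.mem_span_singleton_self w)
    have := Submodule.finrank_lt_finrank_of_lt hlt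
    unfold coneDim at hd
    omega

theorem exists_pos_smul_add {F C : PointedCone ℝ V} (hF : F.IsFaceOf C)
    (hd : coneDim C = coneDim F + 1) {w w' : V} (hw : w ∈ C) (hwF : w ∉ F) (hw' : w' ∈ C)
    (hwF' : w' ∉ F) : ∃ a : ℝ, 0 < a ∧ ∃ s ∈ Submodule.span ℝ (F : Set V), w' = a • w + s := by
  have h1 : w' ∈ Submodule.span ℝ (F : Set V) ⊔ Submodule.span ℝ {w} := by
    rw [← span_cone_eq hF hd hw hwF]
    exact Submodule.subset_span hw'
  obtain ⟨s, hs, y, hy, rfl⟩ := Submodule.mem_sup.1 h1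
  obtain ⟨a, rfl⟩ := Submodule.mem_span_singleton.1 hy
  refine ⟨a, ?_, s, hs, add_comm _ _⟩
  by_contra ha
  rw [not_lt] at ha
  apply hwF'
  have hsC : s ∈ C := by
    have := C.add_mem hw' (C.smul_mem (neg_nonneg.2 ha) hw)
    simpa using this
  have hsF := mem_face_of_mem_span hF hsC hs
  refine hF.mem_of_smul_add_mem (y := (-a) • w) hw' (C.smul_mem (neg_nonneg.2 ha) hw) one_pos ?_
  simpa using hsF

end Convex

/-! ### Flags of cones and their prime congruences -/

section Flags

variable {M : Type*} [AddCommGroup M]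

/-- A flag `C_0 ≤ C_1 ≤ ⋯ ≤ C_k` of cones in `ℝ_{≥0} × N_ℝ`, with `dim C_i = i + 1`; here `≤` means
"is a face of". -/
structure ConeFlag (M : Type*) [AddCommGroup M] (k : ℕ) where
  cone : Fin (k + 1) → PointedCone ℝ (ℝ × NR M)
  isCone : ∀ i, IsCone (cone i)
  nonneg : ∀ i, ∀ w ∈ cone i, 0 ≤ w.1
  dim : ∀ i, coneDim (cone i) = (i : ℕ) + 1
  face : ∀ i : Fin k, (cone i.castSucc).IsFaceOf (cone i.succ)

/-- A flag of cones is simplicial if each of its cones is simplicial. -/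
def ConeFlag.IsSimplicial {k : ℕ} (C : ConeFlag M k) : Prop := ∀ i, (C.cone i).IsSimplicial

/-- `w = (w_0, …, w_k)` satisfies `w_i ∈ C_i \ C_{i-1}` for all `i`, where `C_{-1} = {0}`. -/
structure ConeFlag.IsAdapted {k : ℕ} (C : ConeFlag M k) (w : Fin (k + 1) → ℝ × NR M) : Prop where
  mem : ∀ i, w i ∈ C.cone i
  ne_zero : w 0 ≠ 0
  notMem : ∀ i : Fin k, w i.succ ∉ C.cone i.castSucc

theorem ConeFlag.IsAdapted.nonneg {k : ℕ} {C : ConeFlag M k} {w : Fin (k + 1) → ℝ × NR M}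
    (h : C.IsAdapted w) (i : Fin (k + 1)) : 0 ≤ (w i).1 := C.nonneg i _ (h.mem i)

/-- The homomorphism `ℝ → ℝ^{k+1}`, `a ↦ (r_0 a, …, r_k a)`, where `w_i = (r_i, ξ_i)`. -/
def coeffHom {k : ℕ} (w : Fin (k + 1) → ℝ × NR M) : ℝ →+ Lex (Fin (k + 1) → ℝ) where
  toFun a := toLex fun i => (w i).1 * a
  map_zero' := by
    refine congrArg toLex (funext fun i => ?_)
    simp
  map_add' a b := by
    refine congrArg toLex (funext fun i => ?_)
    simp [mul_add]

theorem coeffHom_monotone {k : ℕ} {w : Fin (k + 1) → ℝ × NR M} (hw : ∀ i, 0 ≤ (w i).1) :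
    Monotone (coeffHom w) := fun _ _ hab =>
  Pi.toLex_monotone fun i => mul_le_mul_of_nonneg_left hab (hw i)

/-- The monoid homomorphism `u ↦ t^(⟨ξ_0, u⟩, …, ⟨ξ_k, u⟩)`, where `w_i = (r_i, ξ_i)`. -/
def exponentHom {k : ℕ} (w : Fin (k + 1) → ℝ × NR M) :
    Multiplicative M →* MaxPlus (Lex (Fin (k + 1) → ℝ)) where
  toFun u := texp (toLex fun i => (w i).2 u.toAdd)
  map_one' := by
    rw [← texp_zero]
    refine congrArg texp (congrArg toLex (funext fun i => ?_))
    simp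
  map_mul' u v := by
    rw [texp_mul_texp]
    refine congrArg texp (congrArg toLex (funext fun i => ?_))
    simp

/-- The semiring homomorphism `φ_w : S[M] → ℝ^{k+1}_{lex} ∪ {-∞}` that sends `a χ^u` to
`(⟨w_0, (log a, u)⟩, …, ⟨w_k, (log a, u)⟩)`, where `⟨(r, ξ), (γ, u)⟩ = r γ + ⟨ξ, u⟩`. -/
def weightHom (S : Subsemiring (MaxPlus ℝ)) {k : ℕ} (w : Fin (k + 1) → ℝ × NR M)
    (hw : ∀ i, 0 ≤ (w i).1) : AddMonoidAlgebra S M →+* MaxPlus (Lex (Fin (k + 1) → ℝ)) :=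
  AddMonoidAlgebra.liftNCRingHom ((MaxPlus.map (coeffHom w) (coeffHom_monotone hw)).comp S.subtype)
    (exponentHom w) fun _ _ => Commute.all _ _

/-- Sanity check: the value of `φ_w` at a term `t^γ χ^u`. -/
theorem weightHom_single (S : Subsemiring (MaxPlus ℝ)) {k : ℕ} (w : Fin (k + 1) → ℝ × NR M)
    (hw : ∀ i, 0 ≤ (w i).1) (γ : ℝ) (hγ : texp γ ∈ S) (u : M) :
    weightHom S w hw (AddMonoidAlgebra.single u ⟨texp γ, hγ⟩) =
      texp (toLex fun i => (w i).1 * γ + (w i).2 u) := by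
  unfold weightHom
  rw [AddMonoidAlgebra.liftNCRingHom_single]
  rfl

/-- The congruence `P_w = ker φ_w` on `S[M]`. -/
def weightCongruence (S : Subsemiring (MaxPlus ℝ)) {k : ℕ} (w : Fin (k + 1) → ℝ × NR M)
    (hw : ∀ i, 0 ≤ (w i).1) : RingCon (AddMonoidAlgebra S M) := RingCon.ker (weightHom S w hw)

theorem ConeFlag.exists_isAdapted [Module.Finite ℤ M] [Module.Free ℤ M] {k : ℕ}
    (C : ConeFlag M k) : ∃ w, C.IsAdapted w := by
  have h0 : ∃ w ∈ C.cone 0, w ≠ 0 := by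
    by_contra! h
    have hd := C.dim 0
    have : Submodule.span ℝ (C.cone 0 : Set (ℝ × NR M)) = ⊥ := by
      rw [Submodule.span_eq_bot]
      exact h
    unfold coneDim at hd
    rw [this, finrank_bot] at hd
    simp at hd
  have hs : ∀ i : Fin k, ∃ w ∈ C.cone i.succ, w ∉ C.cone i.castSucc := by
    intro i
    by_contra! h
    have h1 : Module.finrank ℝ (Submodule.span ℝ (C.cone i.succ : Set (ℝ × NR M))) ≤
        Module.finrank ℝ (Submodule.span ℝ (C.cone i.castSucc : Set (ℝ × NR M))) :=
      Submodule.finrank_mono (Submodule.span_mono h)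
    have h2 := C.dim i.succ
    have h3 := C.dim i.castSucc
    unfold coneDim at h2 h3
    simp at h2 h3
    omega
  obtain ⟨w0, hw0, hw0'⟩ := h0
  choose v hv hv' using hs
  refine ⟨Fin.cons w0 v, ?_, ?_, ?_⟩
  · intro i
    refine Fin.cases ?_ (fun j => ?_) i
    · simpa using hw0
    · simpa using hv j
  · simpa using hw0'
  · intro i
    simpa using hv' i

/-- The prime congruence `P_{C_•}` on `S[M]` that a flag of cones `C_•` defines: it is `P_w` for any
choice of `w_i ∈ C_i \ C_{i-1}`; see `ConeFlag.primeCongruence_eq` for the independence of the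
choice. -/
def ConeFlag.primeCongruence [Module.Finite ℤ M] [Module.Free ℤ M]
    (S : Subsemiring (MaxPlus ℝ)) {k : ℕ} (C : ConeFlag M k) : RingCon (AddMonoidAlgebra S M) :=
  weightCongruence S C.exists_isAdapted.choose C.exists_isAdapted.choose_spec.nonneg

/-- The linear endomorphism of `ℝ^{k+1}` with matrix `A`, with respect to the lexicographic
order. -/
def lexMap {k : ℕ} (A : Fin (k + 1) → Fin (k + 1) → ℝ) :
    Lex (Fin (k + 1) → ℝ) →+ Lex (Fin (k + 1) → ℝ) where
  toFun v := toLex fun i => ∑ j, A i j * ofLex v j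
  map_zero' := by
    refine congrArg toLex (funext fun i => ?_)
    exact Finset.sum_eq_zero fun j _ => mul_zero _
  map_add' a b := by
    refine congrArg toLex (funext fun i => ?_)
    refine Eq.trans (Finset.sum_congr rfl fun j _ => ?_) Finset.sum_add_distrib
    exact mul_add (A i j) (ofLex a j) (ofLex b j)

theorem lexMap_strictMono {k : ℕ} {A : Fin (k + 1) → Fin (k + 1) → ℝ}
    (h0 : ∀ i j, i < j → A i j = 0) (h1 : ∀ i, 0 < A i i) : StrictMono (lexMap A) := by
  intro v v' h
  obtain ⟨i, hi, hlt⟩ := h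
  refine ⟨i, fun j hj => ?_, ?_⟩
  · change ∑ l, A j l * ofLex v l = ∑ l, A j l * ofLex v' l
    refine Finset.sum_congr rfl fun l _ => ?_
    rcases lt_or_ge j l with hl | hl
    · rw [h0 j l hl]; simp
    · congr 1
      exact hi l (hl.trans_lt hj)
  · change ∑ l, A i l * ofLex v l < ∑ l, A i l * ofLex v' l
    refine Finset.sum_lt_sum (fun l _ => ?_) ⟨i, Finset.mem_univ _, ?_⟩
    · rcases lt_trichotomy i l with hl | rfl | hl
      · rw [h0 i l hl]; simp
      · exact mul_le_mul_of_nonneg_left hlt.le (h1 i).le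
      · exact le_of_eq (congrArg _ (hi l hl))
    · exact mul_lt_mul_of_pos_left hlt (h1 i)

theorem ConeFlag.IsAdapted.exists_matrix [Module.Finite ℤ M] [Module.Free ℤ M] {k : ℕ}
    {C : ConeFlag M k} {w w' : Fin (k + 1) → ℝ × NR M} (h : C.IsAdapted w) (h' : C.IsAdapted w') :
    ∃ A : Fin (k + 1) → Fin (k + 1) → ℝ, (∀ i j, i < j → A i j = 0) ∧ (∀ i, 0 < A i i) ∧
      ∀ i, w' i = ∑ j, A i j • w j := by
  classical
  have hb : PointedCone.IsFaceOf ⊥ (C.cone 0) := bot_isFaceOf (C.isCone 0).stronglyConvex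
  have hbd : coneDim (C.cone 0) = coneDim (⊥ : PointedCone ℝ (ℝ × NR M)) + 1 := by
    rw [C.dim 0]
    have : coneDim (⊥ : PointedCone ℝ (ℝ × NR M)) = 0 := by
      unfold coneDim
      have : Submodule.span ℝ ((⊥ : PointedCone ℝ (ℝ × NR M)) : Set (ℝ × NR M)) = ⊥ := by
        rw [Submodule.span_eq_bot]
        intro x hx
        simpa using hx
      rw [this, finrank_bot]
    simp [this]
  have hsd : ∀ i : Fin k, coneDim (C.cone i.succ) = coneDim (C.cone i.castSucc) + 1 := fun i => by
    rw [C.dim, C.dim]; simp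
  have hspan : ∀ i, Submodule.span ℝ (C.cone i : Set (ℝ × NR M)) ≤
      Submodule.span ℝ (w '' {j | j ≤ i}) := by
    intro i
    induction i using Fin.induction with
    | zero =>
      rw [span_cone_eq hb hbd (h.mem 0) (by simpa using h.ne_zero)]
      refine sup_le (Submodule.span_le.2 fun x hx => ?_) ?_
      · have : x = 0 := by simpa using hx
        rw [this]; exact Submodule.zero_mem _
      · rw [Submodule.span_singleton_le_iff_mem]
        exact Submodule.subset_span ⟨0, le_refl (0 : Fin (k + 1)), rfl⟩
    | succ i ih =>
      rw [span_cone_eq (C.face i) (hsd i) (h.mem i.succ) (h.notMem i)]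
      refine sup_le (ih.trans (Submodule.span_mono (Set.image_mono fun j hj => ?_))) ?_
      · exact le_trans (show j ≤ i.castSucc from hj) (Fin.castSucc_lt_succ).le
      · rw [Submodule.span_singleton_le_iff_mem]
        exact Submodule.subset_span ⟨i.succ, le_refl i.succ, rfl⟩
  have hrow : ∀ i, ∃ a : ℝ, 0 < a ∧ ∃ s ∈ Submodule.span ℝ (w '' {j | j < i}),
      w' i = a • w i + s := by
    intro i
    refine Fin.cases ?_ (fun i => ?_) i
    · obtain ⟨a, ha, s, hs, e⟩ := exists_pos_smul_add hb hbd (h.mem 0) (by simpa using h.ne_zero)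
        (h'.mem 0) (by simpa using h'.ne_zero)
      refine ⟨a, ha, s, ?_, e⟩
      have : s = 0 := by
        have h2 : Submodule.span ℝ ((⊥ : PointedCone ℝ (ℝ × NR M)) : Set (ℝ × NR M)) = ⊥ := by
          rw [Submodule.span_eq_bot]
          intro x hx
          simpa using hx
        rw [h2] at hs
        simpa using hs
      rw [this]; exact Submodule.zero_mem _
    · obtain ⟨a, ha, s, hs, e⟩ := exists_pos_smul_add (C.face i) (hsd i) (h.mem i.succ)
        (h.notMem i) (h'.mem i.succ) (h'.notMem i)
      refine ⟨a, ha, s, Submodule.span_mono (Set.image_mono fun j hj => ?_) (hspan _ hs), e⟩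
      exact lt_of_le_of_lt (show j ≤ i.castSucc from hj) Fin.castSucc_lt_succ
  choose a ha s hs e using hrow
  have hc : ∀ i, ∃ c : Fin (k + 1) → ℝ, (∀ j, i ≤ j → c j = 0) ∧ s i = ∑ j, c j • w j := by
    intro i
    obtain ⟨l, hl, hl'⟩ := (Finsupp.mem_span_image_iff_linearCombination ℝ).1 (hs i)
    refine ⟨l, fun j hj => ?_, ?_⟩
    · by_contra hne
      have := (Finsupp.mem_supported _ _).1 hl (Finsupp.mem_support_iff.2 hne)
      exact absurd hj (not_le.2 this)
    · rw [← hl', Finsupp.linearCombination_apply, Finsupp.sum_fintype]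
      exact fun j => zero_smul _ _
  choose c hc0 hc using hc
  refine ⟨fun i j => if j = i then a i else c i j, fun i j hij => ?_, fun i => ?_, fun i => ?_⟩
  · simp [hij.ne', hc0 i j hij.le]
  · simpa using ha i
  · rw [e i, hc i, ← Finset.add_sum_erase _ _ (Finset.mem_univ i),
      ← Finset.add_sum_erase (a := i) _ _ (Finset.mem_univ i), hc0 i i le_rfl]
    simp only [if_true, zero_smul, zero_add]
    congr 1
    refine Finset.sum_congr rfl fun j hj => ?_
    rw [if_neg (Finset.ne_of_mem_erase hj)]

/-- The congruence `P_{C_•}` does not depend on the choice of `w`. -/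
theorem ConeFlag.primeCongruence_eq [Module.Finite ℤ M] [Module.Free ℤ M]
    (S : Subsemiring (MaxPlus ℝ)) {k : ℕ} (C : ConeFlag M k) {w : Fin (k + 1) → ℝ × NR M}
    (h : C.IsAdapted w) : C.primeCongruence S = weightCongruence S w h.nonneg := by
  set w' := C.exists_isAdapted.choose with hw'
  have h' : C.IsAdapted w' := C.exists_isAdapted.choose_spec
  change weightCongruence S w' h'.nonneg = _
  obtain ⟨A, hA0, hA1, hA⟩ := h.exists_matrix h'
  have hmono := lexMap_strictMono hA0 hA1
  have hcomp : weightHom S w' h'.nonneg =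
      (MaxPlus.map (lexMap A) hmono.monotone).comp (weightHom S w h.nonneg) := by
    have key : ∀ (γ : ℝ) (hγ : texp γ ∈ S) (u : M),
        weightHom S w' h'.nonneg (AddMonoidAlgebra.single u ⟨texp γ, hγ⟩) =
          MaxPlus.map (lexMap A) hmono.monotone
            (weightHom S w h.nonneg (AddMonoidAlgebra.single u ⟨texp γ, hγ⟩)) := by
      intro γ hγ u
      rw [weightHom_single, weightHom_single, MaxPlus.map_texp]
      refine congrArg texp (congrArg toLex (funext fun i => ?_))
      have hsnd : (w' i).2 u = ∑ j, A i j * (w j).2 u := by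
        rw [hA i, Prod.snd_sum, LinearMap.sum_apply]
        rfl
      have hfst : (w' i).1 = ∑ j, A i j * (w j).1 := by
        rw [hA i, Prod.fst_sum]
        rfl
      rw [hsnd, hfst, Finset.sum_mul, ← Finset.sum_add_distrib]
      refine Finset.sum_congr rfl fun j _ => ?_
      change _ = A i j * ((w j).1 * γ + (w j).2 u)
      ring
    refine RingHom.coe_addMonoidHom_injective (AddMonoidAlgebra.addMonoidHom_ext fun u a => ?_)
    obtain ⟨a, ha⟩ := a
    rcases eq_zero_or_texp a with rfl | ⟨γ, rfl⟩
    · have : AddMonoidAlgebra.single u (⟨0, ha⟩ : S) = 0 := AddMonoidAlgebra.single_zero u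
      rw [this, map_zero, map_zero]
    · exact key γ ha u
  ext f g
  change weightHom S w' h'.nonneg f = weightHom S w' h'.nonneg g ↔
    weightHom S w h.nonneg f = weightHom S w h.nonneg g
  rw [hcomp]
  exact (MaxPlus.map_injective _ hmono.monotone hmono.injective).eq_iff

/-! ### Flags of polyhedra and the cones over them -/

/-- A flag `P_0 ≤ P_1 ≤ ⋯ ≤ P_k` of non-empty strongly convex polyhedra in `N_ℝ`, with
`dim P_i = i`; here `≤` means "is a face of". -/
structure PolyFlag (M : Type*) [AddCommGroup M] (k : ℕ) where
  poly : Fin (k + 1) → Set (NR M)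
  isPolyhedron : ∀ i, IsStronglyConvexPolyhedron (poly i)
  dim : ∀ i, polyDim (poly i) = (i : ℕ)
  face : ∀ i : Fin k, IsExposed ℝ (poly i.succ) (poly i.castSucc)

/-- The closed cone `c(P) ⊆ ℝ_{≥0} × N_ℝ` over `P`: the closure of the cone generated by
`{1} × P`. -/
def coneOver (P : Set (NR M)) : PointedCone ℝ (ℝ × NR M) :=
  (PointedCone.hull ℝ ((fun x : NR M => ((1 : ℝ), x)) '' P)).closure

theorem mk_one_mem_coneOver {P : Set (NR M)} {x : NR M} (hx : x ∈ P) :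
    ((1 : ℝ), x) ∈ coneOver P :=
  subset_closure (PointedCone.subset_hull ⟨x, hx, rfl⟩)

theorem nonneg_of_mem_coneOver [Module.Finite ℤ M] [Module.Free ℤ M] {P : Set (NR M)}
    (φ : (ℝ × NR M) →ₗ[ℝ] ℝ) (hφ : ∀ x ∈ P, 0 ≤ φ (1, x)) {w : ℝ × NR M} (hw : w ∈ coneOver P) :
    0 ≤ φ w := by
  have hcl : IsClosed {w : ℝ × NR M | 0 ≤ φ w} :=
    isClosed_le continuous_const φ.continuous_of_finiteDimensional
  refine closure_minimal (fun v hv => ?_) hcl hw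
  change 0 ≤ φ v
  induction hv using Submodule.span_induction with
  | mem v hv => obtain ⟨x, hx, rfl⟩ := hv; exact hφ x hx
  | zero => simp
  | add u v _ _ hu hv => rw [map_add]; exact add_nonneg hu hv
  | smul a v _ hv =>
    have : φ (a • v) = a.1 * φ v := by
      rw [← Nonneg.coe_smul, map_smul, smul_eq_mul]
    rw [this]
    exact mul_nonneg a.2 hv

/-- The linear functional `(r, x) ↦ r c - l(x)`. -/
def homogenize (l : Module.Dual ℝ (NR M)) (c : ℝ) : Module.Dual ℝ (ℝ × NR M) :=
  c • LinearMap.fst ℝ ℝ (NR M) - l ∘ₗ LinearMap.snd ℝ ℝ (NR M)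

theorem homogenize_apply (l : Module.Dual ℝ (NR M)) (c : ℝ) (w : ℝ × NR M) :
    homogenize l c w = c * w.1 - l w.2 := rfl

/-- The cone over the polyhedron `{x | l(x) ≤ c, …}` is `{(r, x) | r ≥ 0, l(x) ≤ r c, …}`. -/
theorem mem_coneOver_iff [Module.Finite ℤ M] [Module.Free ℤ M]
    {s : Set (Module.Dual ℝ (NR M) × ℝ)} {P : Set (NR M)} (hP : P = {x | ∀ h ∈ s, h.1 x ≤ h.2})
    (hne : P.Nonempty) (w : ℝ × NR M) :
    w ∈ coneOver P ↔ 0 ≤ w.1 ∧ ∀ h ∈ s, 0 ≤ homogenize h.1 h.2 w := by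
  constructor
  · intro hw
    refine ⟨nonneg_of_mem_coneOver (LinearMap.fst ℝ ℝ (NR M)) (fun x _ => zero_le_one) hw,
      fun h hh => nonneg_of_mem_coneOver _ (fun x hx => ?_) hw⟩
    rw [hP] at hx
    have := hx h hh
    rw [homogenize_apply]
    simpa using this
  · have hpos : ∀ w : ℝ × NR M, 0 < w.1 → (∀ h ∈ s, 0 ≤ homogenize h.1 h.2 w) →
        w ∈ PointedCone.hull ℝ ((fun x : NR M => ((1 : ℝ), x)) '' P) := by
      rintro ⟨r, x⟩ hr hw
      have hr : 0 < r := hr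
      have hx : r⁻¹ • x ∈ P := by
        rw [hP]
        intro h hh
        have := hw h hh
        rw [homogenize_apply] at this
        have h2 : h.1 x ≤ h.2 * r := by simpa using this
        rw [map_smul, smul_eq_mul, inv_mul_le_iff₀ hr]
        linarith
      have h3 := Submodule.smul_mem (PointedCone.hull ℝ ((fun x : NR M => ((1 : ℝ), x)) '' P))
        ⟨r, hr.le⟩ (PointedCone.subset_hull ⟨r⁻¹ • x, hx, rfl⟩)
      have h4 : (⟨r, hr.le⟩ : {c : ℝ // 0 ≤ c}) • ((1 : ℝ), r⁻¹ • x) = (r, x) := by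
        rw [← Nonneg.coe_smul]
        ext1
        · simp
        · simp [smul_smul, hr.ne']
      rwa [h4] at h3
    rintro ⟨h0, hw⟩
    obtain ⟨p, hp⟩ := hne
    have hlim : Filter.Tendsto (fun t : ℝ => w + t • ((1 : ℝ), p)) (nhdsWithin 0 (Set.Ioi 0))
        (nhds w) := by
      have hc : Continuous fun t : ℝ => w + t • ((1 : ℝ), p) := by fun_prop
      have := hc.tendsto 0
      rw [zero_smul, add_zero] at this
      exact this.mono_left nhdsWithin_le_nhds
    refine mem_closure_of_tendsto hlim (eventually_nhdsWithin_of_forall fun t ht => ?_)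
    have ht : 0 < t := ht
    refine hpos _ ?_ fun h hh => ?_
    · have : (w + t • ((1 : ℝ), p)).1 = w.1 + t := by simp
      rw [this]; linarith
    · rw [map_add, map_smul, smul_eq_mul]
      refine add_nonneg (hw h hh) (mul_nonneg ht.le ?_)
      rw [hP] at hp
      have := hp h hh
      rw [homogenize_apply]
      simpa using this

theorem isCone_coneOver [Module.Finite ℤ M] [Module.Free ℤ M] {P : Set (NR M)}
    (hP : IsStronglyConvexPolyhedron P) : IsCone (coneOver P) := by
  classical
  obtain ⟨⟨s, hs⟩, ⟨p, hp⟩, hl⟩ := hP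
  have hmem := mem_coneOver_iff (s := (s : Set (Module.Dual ℝ (NR M) × ℝ))) hs ⟨p, hp⟩
  constructor
  · refine ⟨insert (LinearMap.fst ℝ ℝ (NR M)) (s.image fun h => homogenize h.1 h.2), ?_⟩
    ext w
    rw [hmem, PointedCone.mem_dual]
    constructor
    · intro h
      refine ⟨h (x := LinearMap.fst ℝ ℝ (NR M)) (by simp), fun a ha => ?_⟩
      exact h (x := homogenize a.1 a.2) (by
        rw [Finset.coe_insert, Finset.coe_image]
        exact Or.inr ⟨a, ha, rfl⟩)
    · rintro ⟨h0, h1⟩ φ hφ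
      rw [Finset.coe_insert, Finset.coe_image] at hφ
      rcases hφ with rfl | ⟨a, ha, rfl⟩
      · exact h0
      · exact h1 a ha
  · rw [eq_bot_iff]
    intro w hw
    rw [PointedCone.mem_lineal, hmem, hmem] at hw
    obtain ⟨⟨h0, h1⟩, h2, h3⟩ := hw
    have hr : w.1 = 0 := le_antisymm (by simpa using h2) h0
    have hx : w.2 = 0 := by
      refine hl p w.2 fun t => ?_
      rw [hs] at hp ⊢
      intro h hh
      have e1 := h1 h hh
      have e2 := h3 h hh
      rw [map_neg] at e2
      rw [homogenize_apply, hr] at e1 e2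
      have e3 : h.1 w.2 = 0 := by linarith
      rw [map_add, map_smul, e3]
      simpa using hp h hh
    rw [Submodule.mem_bot]
    exact Prod.ext hr hx

theorem coneDim_coneOver [Module.Finite ℤ M] [Module.Free ℤ M] {P : Set (NR M)}
    (hne : P.Nonempty) : coneDim (coneOver P) = polyDim P + 1 := by
  obtain ⟨p, hp⟩ := hne
  let φ : (ℝ × vectorSpan ℝ P) →ₗ[ℝ] ℝ × NR M :=
    (LinearMap.fst ℝ ℝ (vectorSpan ℝ P)).prod
      ((LinearMap.toSpanSingleton ℝ (NR M) p).comp (LinearMap.fst ℝ ℝ (vectorSpan ℝ P)) +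
        (vectorSpan ℝ P).subtype.comp (LinearMap.snd ℝ ℝ (vectorSpan ℝ P)))
  have hφ : ∀ r v, φ (r, v) = (r, r • p + (v : NR M)) := fun r v => rfl
  have hinj : Function.Injective φ := by
    rintro ⟨r, v⟩ ⟨r', v'⟩ h
    rw [hφ, hφ, Prod.mk.injEq] at h
    obtain ⟨rfl, h⟩ := h
    rw [Prod.mk.injEq]
    exact ⟨rfl, Subtype.ext (add_left_cancel h)⟩
  have hrange : Submodule.span ℝ (coneOver P : Set (ℝ × NR M)) = LinearMap.range φ := by
    apply le_antisymm
    · have hcl : IsClosed (LinearMap.range φ : Set (ℝ × NR M)) :=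
        Submodule.closed_of_finiteDimensional _
      refine Submodule.span_le.2 (closure_minimal (fun v hv => ?_) hcl)
      change v ∈ LinearMap.range φ
      induction hv using Submodule.span_induction with
      | mem v hv =>
        obtain ⟨x, hx, rfl⟩ := hv
        refine ⟨(1, ⟨x - p, vsub_mem_vectorSpan ℝ hx hp⟩), ?_⟩
        rw [hφ]
        simp
      | zero => exact Submodule.zero_mem _
      | add u v _ _ hu hv => exact Submodule.add_mem _ hu hv
      | smul a v _ hv =>
        rw [← Nonneg.coe_smul]
        exact Submodule.smul_mem _ _ hv
    · rintro _ ⟨⟨r, v, hv⟩, rfl⟩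
      rw [hφ]
      have h1 : ((1 : ℝ), p) ∈ Submodule.span ℝ (coneOver P : Set (ℝ × NR M)) :=
        Submodule.subset_span (mk_one_mem_coneOver hp)
      have h2 : ((0 : ℝ), v) ∈ Submodule.span ℝ (coneOver P : Set (ℝ × NR M)) := by
        have : vectorSpan ℝ P ≤ (Submodule.span ℝ (coneOver P : Set (ℝ × NR M))).comap
            (LinearMap.inr ℝ ℝ (NR M)) := by
          rw [vectorSpan_def, Submodule.span_le]
          rintro _ ⟨x, hx, y, hy, rfl⟩
          change ((0 : ℝ), x - y) ∈ Submodule.span ℝ (coneOver P : Set (ℝ × NR M))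
          have e : ((0 : ℝ), x - y) = ((1 : ℝ), x) - ((1 : ℝ), y) := by simp
          rw [e]
          exact Submodule.sub_mem _ (Submodule.subset_span (mk_one_mem_coneOver hx))
            (Submodule.subset_span (mk_one_mem_coneOver hy))
        exact this hv
      have e : (r, r • p + v) = r • ((1 : ℝ), p) + ((0 : ℝ), v) := by simp
      rw [e]
      exact Submodule.add_mem _ (Submodule.smul_mem _ _ h1) h2
  unfold coneDim polyDim
  rw [hrange, LinearMap.finrank_range_of_inj hinj, Module.finrank_prod, Module.finrank_self,
    add_comm]

theorem coneOver_isFaceOf [Module.Finite ℤ M] [Module.Free ℤ M] {F P : Set (NR M)}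
    (hP : IsStronglyConvexPolyhedron P) (hF : F.Nonempty) (h : IsExposed ℝ P F) :
    (coneOver F).IsFaceOf (coneOver P) := by
  obtain ⟨⟨s, hs⟩, hPne, -⟩ := hP
  obtain ⟨f, hf⟩ := hF
  obtain ⟨l, hl⟩ := h ⟨f, hf⟩
  have hfP : f ∈ P ∧ ∀ y ∈ P, l y ≤ l f := by
    rw [hl] at hf; exact hf
  let l' : Module.Dual ℝ (NR M) := l
  have hF' : F = {x | ∀ h ∈ insert ((-l', -(l f)) : Module.Dual ℝ (NR M) × ℝ)
      (s : Set (Module.Dual ℝ (NR M) × ℝ)), h.1 x ≤ h.2} := by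
    rw [hl]
    ext x
    rw [Set.mem_ofPred_eq, Set.mem_ofPred_eq, Set.forall_mem_insert]
    have e : x ∈ P ↔ ∀ h ∈ (s : Set (Module.Dual ℝ (NR M) × ℝ)), h.1 x ≤ h.2 := by rw [hs]; rfl
    rw [← e]
    change (x ∈ P ∧ _) ↔ (-(l x) ≤ -(l f) ∧ x ∈ P)
    rw [neg_le_neg_iff]
    exact ⟨fun hx => ⟨hx.2 f hfP.1, hx.1⟩, fun hx => ⟨hx.2, fun y hy => (hfP.2 y hy).trans hx.1⟩⟩
  have hmemP := mem_coneOver_iff (s := (s : Set (Module.Dual ℝ (NR M) × ℝ))) hs hPne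
  have hmemF := mem_coneOver_iff hF' ⟨f, hf⟩
  have hiff : ∀ w, w ∈ coneOver F ↔ w ∈ coneOver P ∧ homogenize l' (l f) w ≤ 0 := by
    intro w
    have e : homogenize (-l') (-(l f)) w = - homogenize l' (l f) w := by
      rw [homogenize_apply, homogenize_apply, LinearMap.neg_apply]; ring
    rw [hmemF, hmemP, Set.forall_mem_insert, e, neg_nonneg]
    tauto
  have hge : ∀ w ∈ coneOver P, 0 ≤ homogenize l' (l f) w := fun w hw => by
    refine nonneg_of_mem_coneOver _ (fun x hx => ?_) hw
    have h1 : l' x ≤ l f := hfP.2 x hx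
    rw [homogenize_apply]
    simpa using h1
  refine ⟨fun w hw => ((hiff w).1 hw).1, fun {x y a} hx hy ha hxy => (hiff x).2 ⟨hx, ?_⟩⟩
  have h1 := ((hiff _).1 hxy).2
  rw [map_add, map_smul, smul_eq_mul] at h1
  have h2 := hge y hy
  by_contra hlt
  have h3 : 0 < a * homogenize l' (l f) x := mul_pos ha (not_le.1 hlt)
  linarith

/-- The flag of cones `c(P_•) = (c(P_0) ≤ ⋯ ≤ c(P_k))` of a flag of polyhedra `P_•`. -/
def PolyFlag.coneFlag [Module.Finite ℤ M] [Module.Free ℤ M] {k : ℕ} (P : PolyFlag M k) :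
    ConeFlag M k where
  cone i := coneOver (P.poly i)
  isCone i := isCone_coneOver (P.isPolyhedron i)
  nonneg i _ hw :=
    nonneg_of_mem_coneOver (LinearMap.fst ℝ ℝ (NR M)) (fun _ _ => zero_le_one) hw
  dim i := by rw [coneDim_coneOver (P.isPolyhedron i).nonempty, P.dim i]
  face i := coneOver_isFaceOf (P.isPolyhedron i.succ) (P.isPolyhedron i.castSucc).nonempty
    (P.face i)

/-- The prime congruence `P_{P_•} = P_{c(P_•)}` on `S[M]` that a flag of polyhedra defines. -/
def PolyFlag.primeCongruence [Module.Finite ℤ M] [Module.Free ℤ M]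
    (S : Subsemiring (MaxPlus ℝ)) {k : ℕ} (P : PolyFlag M k) : RingCon (AddMonoidAlgebra S M) :=
  P.coneFlag.primeCongruence S

/-! ### Neighborhoods of flags and local equivalence -/

/-- `D ⊆ ℝ_{≥0} × N_ℝ` is a `Γ`-admissible cone: it has the form
`{(r, x) | r ≥ 0, r γ_i + ⟨x, u_i⟩ ≤ 0 for all i}` with finitely many `γ_i ∈ Γ` and `u_i ∈ M`. -/
def IsAdmissibleCone (Γ : Set ℝ) (D : Set (ℝ × NR M)) : Prop :=
  ∃ (q : ℕ) (u : Fin q → M) (γ : Fin q → ℝ), (∀ i, γ i ∈ Γ) ∧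
    D = {w | 0 ≤ w.1 ∧ ∀ i, w.1 * γ i + w.2 (u i) ≤ 0}

/-- `Q ⊆ N_ℝ` is a `Γ`-rational polyhedron: it has the form `{x | ⟨x, u_i⟩ ≤ γ_i for all i}` with
finitely many `γ_i ∈ Γ` and `u_i ∈ M`. -/
def IsRationalPolyhedron (Γ : Set ℝ) (Q : Set (NR M)) : Prop :=
  ∃ (q : ℕ) (u : Fin q → M) (γ : Fin q → ℝ), (∀ i, γ i ∈ Γ) ∧ Q = {x | ∀ i, x (u i) ≤ γ i}

/-- A `Γ`-admissible neighborhood of a flag of cones: a `Γ`-admissible cone that meets the relative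
interior of each cone of the flag. -/
def ConeFlag.IsAdmissibleNhd (Γ : Set ℝ) {k : ℕ} (C : ConeFlag M k) (D : Set (ℝ × NR M)) : Prop :=
  IsAdmissibleCone Γ D ∧
    ∀ i, (D ∩ intrinsicInterior ℝ (C.cone i : Set (ℝ × NR M))).Nonempty

/-- A `Γ`-rational neighborhood of a flag of polyhedra: a `Γ`-rational polyhedron that meets the
relative interior of each polyhedron of the flag. -/
def PolyFlag.IsRationalNhd (Γ : Set ℝ) {k : ℕ} (P : PolyFlag M k) (Q : Set (NR M)) : Prop :=
  IsRationalPolyhedron Γ Q ∧ ∀ i, (Q ∩ intrinsicInterior ℝ (P.poly i)).Nonempty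

/-- Two flags of cones are `Γ`-locally equivalent if they have the same `Γ`-admissible
neighborhoods. -/
def ConeFlag.LocallyEquivalent (Γ : Set ℝ) {k k' : ℕ} (C : ConeFlag M k) (C' : ConeFlag M k') :
    Prop :=
  ∀ D : Set (ℝ × NR M), C.IsAdmissibleNhd Γ D ↔ C'.IsAdmissibleNhd Γ D

/-- Two flags of polyhedra are `Γ`-locally equivalent if they have the same `Γ`-rational
neighborhoods. -/
def PolyFlag.LocallyEquivalent (Γ : Set ℝ) {k k' : ℕ} (P : PolyFlag M k) (P' : PolyFlag M k') :
    Prop :=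
  ∀ Q : Set (NR M), P.IsRationalNhd Γ Q ↔ P'.IsRationalNhd Γ Q

end Flags

end

end FlagPrime

/-! Both equivalences rest on one invariant of a flag: the set of pairs `(γ, u)` with `γ ∈ Γ` such
that `t^γ χ^u` is at most `1` modulo the congruence, that is, such that the vector of the `⟨w_i, (γ,
u)⟩` is lexicographically nonpositive (`ConeFlag.TermLeOne`).

This set determines the congruence. The value `φ(f)` is the maximum of the values of the terms of
`f`, so `φ(f) ≤ φ(g)` means that each term of `f` is at most some term of `g`. Since `S` is a
semifield, two terms are compared by comparing their quotient with `1`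
(`weightCongruence_eq_of_forall_term`).

The set also determines the neighborhoods, and conversely: finitely many half-spaces `⟨·, (γ_a,
u_a)⟩ ≤ 0` cut out a neighborhood exactly when every `t^(γ_a) χ^(u_a)` is at most `1`
(`ConeFlag.forall_exists_iff_forall_termLeOne`). If the intersection contains points `p_i` in the
relative interiors, these points are themselves an admissible choice of the `w_i`, and all
coordinates are nonpositive. Conversely, move from `p_{i-1}` slightly towards `w_i`: for small steps
the sign of a form at `p_i` is the sign of its first nonzero value among `w_0, …, w_i`, which is
negative if there is one (`exists_mem_forall_nonpos`). Single half-spaces recover single terms.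

For polyhedra the same argument runs at height `r = 1`, with `{1} × relint P_i` in place of `relint
C_i`. -/

namespace FlagPrime

/-! ### Relative interiors of convex sets -/

section RelativeInterior

variable {V : Type*} [AddCommGroup V] [Module ℝ V] [TopologicalSpace V]

/-- Trades the subtype topology of the affine span for `nhdsWithin` in `V`, so that the next lemmas
can argue with limits. -/
theorem mem_intrinsicInterior_iff_mem_nhdsWithin {s : Set V} {x : V} :
    x ∈ intrinsicInterior ℝ s ↔
      x ∈ affineSpan ℝ s ∧ s ∈ nhdsWithin x (affineSpan ℝ s : Set V) := by
  rw [mem_intrinsicInterior]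
  constructor
  · rintro ⟨⟨y, hy⟩, h, rfl⟩
    refine ⟨hy, ?_⟩
    rw [mem_interior_iff_mem_nhds] at h
    exact preimage_coe_mem_nhds_subtype.1 h
  · rintro ⟨hx, h⟩
    refine ⟨⟨x, hx⟩, ?_, rfl⟩
    rw [mem_interior_iff_mem_nhds]
    exact preimage_coe_mem_nhds_subtype.2 h

variable [IsTopologicalAddGroup V] [ContinuousSMul ℝ V]

/-- The line through `q` and `p` lies in the affine span, and `p + t • (p - q)` tends to `p` as `t →
0+`. Hence a segment ending at a relative interior point can be prolonged. -/
theorem exists_add_smul_sub_mem_of_mem_intrinsicInterior {s : Set V} {p q : V}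
    (hp : p ∈ intrinsicInterior ℝ s) (hq : q ∈ s) : ∃ t : ℝ, 0 < t ∧ p + t • (p - q) ∈ s := by
  obtain ⟨hpa, hps⟩ := mem_intrinsicInterior_iff_mem_nhdsWithin.1 hp
  have hc : Filter.Tendsto (fun t : ℝ => p + t • (p - q)) (nhdsWithin 0 (Set.Ioi 0))
      (nhdsWithin p (affineSpan ℝ s : Set V)) := by
    refine tendsto_nhdsWithin_iff.2 ⟨?_, Filter.Eventually.of_forall fun t => ?_⟩
    · have hc : Continuous fun t : ℝ => p + t • (p - q) := by fun_prop
      have := hc.tendsto 0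
      rw [zero_smul, add_zero] at this
      exact this.mono_left nhdsWithin_le_nhds
    · have := AffineSubspace.smul_vsub_vadd_mem (affineSpan ℝ s) t hpa
        (subset_affineSpan ℝ s hq) hpa
      rw [vsub_eq_sub, vadd_eq_add, add_comm] at this
      exact this
  obtain ⟨t, ht, ht0⟩ := ((hc.eventually hps).and self_mem_nhdsWithin).exists
  exact ⟨t, ht0, ht⟩

/-- The homothety with centre `p` and ratio `ε` sends `w` to the new point `z` and, by convexity,
maps `s` into itself. Its inverse `y ↦ w + ε⁻¹ • (y - z)` is continuous and preserves the affine
span, so it pulls a neighborhood of `w` back to one of `z`. -/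
theorem combo_mem_intrinsicInterior {s : Set V} (hs : Convex ℝ s) {p w : V} (hp : p ∈ s)
    (hw : w ∈ intrinsicInterior ℝ s) {ε : ℝ} (h0 : 0 < ε) (h1 : ε < 1) :
    (1 - ε) • p + ε • w ∈ intrinsicInterior ℝ s := by
  obtain ⟨hwa, hws⟩ := mem_intrinsicInterior_iff_mem_nhdsWithin.1 hw
  have hpa := subset_affineSpan ℝ s hp
  set z := (1 - ε) • p + ε • w with hz
  have hza : z ∈ affineSpan ℝ s := by
    have := AffineSubspace.smul_vsub_vadd_mem (affineSpan ℝ s) ε hwa hpa hpa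
    rw [vsub_eq_sub, vadd_eq_add] at this
    convert this using 1
    rw [hz]; module
  have hc : Filter.Tendsto (fun y : V => w + ε⁻¹ • (y - z))
      (nhdsWithin z (affineSpan ℝ s : Set V)) (nhdsWithin w (affineSpan ℝ s : Set V)) := by
    refine tendsto_nhdsWithin_iff.2 ⟨?_, Filter.eventually_of_mem self_mem_nhdsWithin fun y hy => ?_⟩
    · have hc : Continuous fun y : V => w + ε⁻¹ • (y - z) := by fun_prop
      have := hc.tendsto z
      rw [sub_self, smul_zero, add_zero] at this
      exact this.mono_left nhdsWithin_le_nhds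
    · have := AffineSubspace.smul_vsub_vadd_mem (affineSpan ℝ s) ε⁻¹ hy hza hwa
      rw [vsub_eq_sub, vadd_eq_add, add_comm] at this
      exact this
  refine mem_intrinsicInterior_iff_mem_nhdsWithin.2 ⟨hza, ?_⟩
  filter_upwards [hc.eventually hws] with y hy
  have := hs hp hy (sub_nonneg.2 h1.le) h0.le (by ring)
  convert this using 1
  rw [smul_add, smul_smul, mul_inv_cancel₀ h0.ne', one_smul, hz]
  abel

/-- For `q ∈ C`, prolong the segment from `q` through `p` inside `C`. Then a positive multiple of
`p` is a sum of two points of `C`, one of them a positive multiple of `q`, so `p ∈ F` would force `q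
∈ F`. -/
theorem notMem_intrinsicInterior_of_isFaceOf {F C : PointedCone ℝ V} (hF : F.IsFaceOf C)
    (hlt : ¬ C ≤ F) {p : V} (hp : p ∈ intrinsicInterior ℝ (C : Set V)) :
    p ∉ F := by
  intro hpF
  refine hlt fun q hq => ?_
  obtain ⟨t, ht, h⟩ := exists_add_smul_sub_mem_of_mem_intrinsicInterior hp (q := q) hq
  refine hF.mem_of_smul_add_mem hq h ht ?_
  have e : t • q + (p + t • (p - q)) = (1 + t) • p := by module
  rw [e]
  exact F.smul_mem (add_nonneg zero_le_one ht.le) hpF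

/-- `V` has a vector space topology but no chosen norm, so the result is transported from `Fin n →
ℝ` along a linear homeomorphism, which commutes with relative interiors. -/
theorem intrinsicInterior_nonempty_of_convex [T2Space V] [FiniteDimensional ℝ V] {s : Set V}
    (hs : Convex ℝ s) (hne : s.Nonempty) : (intrinsicInterior ℝ s).Nonempty := by
  let e : V ≃L[ℝ] (Fin (Module.finrank ℝ V) → ℝ) :=
    ContinuousLinearEquiv.ofFinrankEq (by simp)
  have h : (intrinsicInterior ℝ (e.toContinuousAffineEquiv '' s)).Nonempty :=
    (hne.image _).intrinsicInterior (hs.linear_image e.toLinearEquiv.toLinearMap)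
  rw [ContinuousAffineEquiv.intrinsicInterior_image] at h
  exact h.of_image

end RelativeInterior

/-! ### Lexicographic signs and points of small perturbation -/

section LexSign

variable {k : ℕ}

theorem apply_nonpos_of_toLex_nonpos {v : Fin (k + 1) → ℝ} (h : toLex v ≤ 0) (i : Fin (k + 1))
    (hi : ∀ j < i, v j = 0) : v i ≤ 0 := by
  rcases h.eq_or_lt with h | ⟨m, hm, hlt⟩
  · have : v i = 0 := congrFun (congrArg ofLex h) i
    exact this.le
  · have hlt : v m < 0 := hlt
    have hm : ∀ j < m, v j = 0 := hm
    rcases lt_trichotomy i m with h | rfl | h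
    · exact (hm i h).le
    · exact hlt.le
    · exact absurd (hi m h) hlt.ne

theorem toLex_nonpos_of_forall {v : Fin (k + 1) → ℝ} (h : ∀ i, v i ≤ 0) : toLex v ≤ 0 :=
  Pi.toLex_monotone (show v ≤ 0 from h)

/-- If finitely many linear forms are lexicographically nonpositive on `(w_0, …, w_k)`, then they
are nonpositive at suitable points `(1 - ε_i) p_{i-1} + ε_i w_i`. -/
theorem exists_mem_forall_nonpos {V : Type*} [AddCommGroup V] [Module ℝ V]
    {R : Fin (k + 1) → Set V} {w : Fin (k + 1) → V} (hw : ∀ i, w i ∈ R i)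
    (hR : ∀ (i : Fin k), ∀ p ∈ R i.castSucc, ∀ ε : ℝ, 0 < ε → ε < 1 →
      (1 - ε) • p + ε • w i.succ ∈ R i.succ)
    {ι : Type*} [Finite ι] (l : ι → Module.Dual ℝ V)
    (hl : ∀ a, toLex (fun i => l a (w i)) ≤ 0) (i : Fin (k + 1)) :
    ∃ p ∈ R i, ∀ a, l a p ≤ 0 := by
  -- The induction needs the extra clause: a form vanishes at `p` only if it vanishes at all earlier
  -- `w j`, which is when the lexicographic hypothesis controls its sign at the next `w`.
  suffices h : ∃ p ∈ R i, ∀ a, l a p ≤ 0 ∧ (l a p = 0 → ∀ j ≤ i, l a (w j) = 0) by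
    obtain ⟨p, hp, h⟩ := h
    exact ⟨p, hp, fun a => (h a).1⟩
  induction i using Fin.induction with
  | zero =>
    refine ⟨w 0, hw 0, fun a => ⟨?_, fun h j hj => ?_⟩⟩
    · exact apply_nonpos_of_toLex_nonpos (hl a) 0 fun j hj => absurd hj (Fin.not_lt_zero j)
    · rwa [Fin.le_zero_iff.1 hj]
  | succ i ih =>
    obtain ⟨p, hp, h⟩ := ih
    have key : ∀ a, ∀ᶠ ε : ℝ in nhdsWithin 0 (Set.Ioi 0),
        l a ((1 - ε) • p + ε • w i.succ) ≤ 0 ∧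
          (l a ((1 - ε) • p + ε • w i.succ) = 0 → ∀ j ≤ i.succ, l a (w j) = 0) := by
      intro a
      have e : ∀ ε : ℝ, l a ((1 - ε) • p + ε • w i.succ) =
          (1 - ε) * l a p + ε * l a (w i.succ) := fun ε => by simp
      simp only [e]
      -- A form negative at `p` stays negative for small `ε`. A form zero at `p` takes the value `ε
      -- * l a (w i.succ)`, whose second factor is then nonpositive.
      rcases (h a).1.lt_or_eq with hneg | hzero
      · have hc : Continuous fun ε : ℝ => (1 - ε) * l a p + ε * l a (w i.succ) := by fun_prop
        have h0 := hc.tendsto 0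
        rw [sub_zero, one_mul, zero_mul, add_zero] at h0
        filter_upwards [nhdsWithin_le_nhds (h0.eventually_lt_const hneg)] with ε hε
        exact ⟨hε.le, fun h => absurd h hε.ne⟩
      · have hj := (h a).2 hzero
        filter_upwards [self_mem_nhdsWithin] with ε hε
        have hε : 0 < ε := hε
        rw [hzero, mul_zero, zero_add]
        have hs : l a (w i.succ) ≤ 0 :=
          apply_nonpos_of_toLex_nonpos (hl a) i.succ fun j hji =>
            hj j (Fin.le_castSucc_iff.2 hji)
        refine ⟨mul_nonpos_of_nonneg_of_nonpos hε.le hs, fun h0 j hji => ?_⟩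
        rcases hji.eq_or_lt with rfl | hji
        · exact (mul_eq_zero.1 h0).resolve_left hε.ne'
        · exact hj j (Fin.le_castSucc_iff.2 hji)
    have hlt : ∀ᶠ ε : ℝ in nhdsWithin 0 (Set.Ioi 0), ε < 1 :=
      nhdsWithin_le_nhds (eventually_lt_nhds one_pos)
    -- Finiteness of `ι` allows one `ε` for all forms at once.
    obtain ⟨ε, ⟨hε, h1⟩, h0⟩ :=
      (((Filter.eventually_all.2 key).and hlt).and self_mem_nhdsWithin).exists
    exact ⟨_, hR i p hp ε h0 h1, hε⟩

end LexSign

/-! ### The order on terms determines the congruence -/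

section TermOrder

variable {G : Type*} [LinearOrder G]

/-- The equation `x + z = z` expresses that `x` is at most `z` in the max-plus order. The order
carried by `Tropical` is the opposite one, so it is avoided in the statements. -/
theorem MaxPlus.add_add_eq_iff {x y z : MaxPlus G} : x + y + z = z ↔ x + z = z ∧ y + z = z := by
  rw [Tropical.add_eq_right_iff, Tropical.add_eq_right_iff, Tropical.add_eq_right_iff]
  exact le_min_iff

theorem MaxPlus.add_add_eq_iff_or {x y z : MaxPlus G} :
    x + (y + z) = y + z ↔ x + y = y ∨ x + z = z := by
  rw [Tropical.add_eq_right_iff, Tropical.add_eq_right_iff, Tropical.add_eq_right_iff]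
  exact min_le_iff

theorem MaxPlus.eq_iff_add_eq {x y : MaxPlus G} : x = y ↔ x + y = y ∧ y + x = x := by
  rw [Tropical.add_eq_right_iff, Tropical.add_eq_right_iff]
  exact ⟨fun h => ⟨h.ge, h.le⟩, fun h => le_antisymm h.2 h.1⟩

theorem texp_add_eq_iff [AddCommGroup G] [IsOrderedAddMonoid G] {a b : G} :
    texp a + texp b = texp b ↔ a ≤ b := by
  rw [texp_add_texp, texp_injective.eq_iff, max_eq_right_iff]

end TermOrder

/-! ### Terms as linear forms on `ℝ × N_ℝ`, and the terms at most `1` modulo a flag. -/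

section Flags

variable {M : Type*} [AddCommGroup M]

/-- The linear form `⟨·, (γ, u)⟩` on `ℝ × N_ℝ`, that is `(r, ξ) ↦ r γ + ⟨ξ, u⟩`. -/
def termForm (γ : ℝ) (u : M) : Module.Dual ℝ (ℝ × NR M) where
  toFun w := w.1 * γ + w.2 u
  map_add' v w := by
    change (v.1 + w.1) * γ + (v.2 u + w.2 u) = _
    ring
  map_smul' a w := by
    change (a * w.1) * γ + a * w.2 u = a * (w.1 * γ + w.2 u)
    ring

theorem termForm_apply (γ : ℝ) (u : M) (w : ℝ × NR M) : termForm γ u w = w.1 * γ + w.2 u := rfl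

/-- The inverse of `t^b` in `S` can only be `t^(-b)`. This makes quotients of terms available, and
shows `Γ = -Γ`. -/
theorem IsSubsemifield.sub_mem {S : Subsemiring (MaxPlus ℝ)} (hS : IsSubsemifield S) {a b : ℝ}
    (ha : texp a ∈ S) (hb : texp b ∈ S) : texp (a - b) ∈ S := by
  obtain ⟨c, hc, hbc⟩ := hS _ hb (texp_ne_zero b)
  rcases eq_zero_or_texp c with rfl | ⟨c, rfl⟩
  · rw [mul_zero, ← texp_zero] at hbc
    exact absurd hbc.symm (texp_ne_zero _)
  · rw [texp_mul_texp, ← texp_zero] at hbc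
    have h : c = -b := (neg_eq_of_add_eq_zero_right (texp_injective hbc)).symm
    rw [sub_eq_add_neg, ← texp_mul_texp, ← h]
    exact S.mul_mem ha hc

/-- A pair `(f + 1, 1)` in the congruence says that `f` is at most `1` in the quotient, so the
lexicographic sign of a term is visible in the congruence itself. -/
theorem weightCongruence_single_add_one {S : Subsemiring (MaxPlus ℝ)} {k : ℕ}
    {w : Fin (k + 1) → ℝ × NR M} (hw : ∀ i, 0 ≤ (w i).1) {γ : ℝ} (hγ : texp γ ∈ S) (u : M) :
    weightCongruence S w hw (AddMonoidAlgebra.single u ⟨texp γ, hγ⟩ + 1) 1 ↔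
      toLex (fun i => termForm γ u (w i)) ≤ 0 := by
  change weightHom S w hw _ = weightHom S w hw _ ↔ _
  rw [map_add, map_one, weightHom_single, ← texp_zero, texp_add_eq_iff]
  rfl

/-- The congruence `P_w` is determined by the set of terms that are at most `1`. -/
theorem weightCongruence_eq_of_forall_term {S : Subsemiring (MaxPlus ℝ)} (hS : IsSubsemifield S)
    {k k' : ℕ} {w : Fin (k + 1) → ℝ × NR M} (hw : ∀ i, 0 ≤ (w i).1)
    {w' : Fin (k' + 1) → ℝ × NR M} (hw' : ∀ i, 0 ≤ (w' i).1)
    (h : ∀ γ, texp γ ∈ S → ∀ u : M, toLex (fun i => termForm γ u (w i)) ≤ 0 ↔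
      toLex (fun i => termForm γ u (w' i)) ≤ 0) :
    weightCongruence S w hw = weightCongruence S w' hw' := by
  -- Inequalities rather than equalities are compared, because they decompose: a maximum lies below
  -- `g` when all its terms do, and a single term lies below a maximum when it lies below one of its
  -- terms.
  have key : ∀ f g, weightHom S w hw f + weightHom S w hw g = weightHom S w hw g ↔
      weightHom S w' hw' f + weightHom S w' hw' g = weightHom S w' hw' g := by
    intro f g
    induction f using AddMonoidAlgebra.induction_linear with
    | zero => simp
    | add f₁ f₂ h₁ h₂ =>
      rw [map_add, map_add, MaxPlus.add_add_eq_iff, MaxPlus.add_add_eq_iff, h₁, h₂]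
    | single u a =>
      obtain ⟨a, ha⟩ := a
      rcases eq_zero_or_texp a with rfl | ⟨a, rfl⟩
      · have : AddMonoidAlgebra.single u (⟨0, ha⟩ : S) = 0 := AddMonoidAlgebra.single_zero u
        simp [this]
      induction g using AddMonoidAlgebra.induction_linear with
      | zero =>
        rw [map_zero, map_zero, add_zero, add_zero, weightHom_single, weightHom_single]
        exact iff_of_false (texp_ne_zero _) (texp_ne_zero _)
      | add g₁ g₂ h₁ h₂ =>
        rw [map_add, map_add, MaxPlus.add_add_eq_iff_or, MaxPlus.add_add_eq_iff_or, h₁, h₂]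
      | single v b =>
        obtain ⟨b, hb⟩ := b
        rcases eq_zero_or_texp b with rfl | ⟨b, rfl⟩
        · have : AddMonoidAlgebra.single v (⟨0, hb⟩ : S) = 0 := AddMonoidAlgebra.single_zero v
          rw [this, map_zero, map_zero, add_zero, add_zero, weightHom_single, weightHom_single]
          exact iff_of_false (texp_ne_zero _) (texp_ne_zero _)
        · have e : ∀ {n : ℕ} (x : Fin (n + 1) → ℝ × NR M),
              (toLex fun i => (x i).1 * a + (x i).2 u) - (toLex fun i => (x i).1 * b + (x i).2 v) =
                toLex fun i => termForm (a - b) (u - v) (x i) := by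
            intro n x
            refine congrArg toLex (funext fun i => ?_)
            change (x i).1 * a + (x i).2 u - ((x i).1 * b + (x i).2 v) =
              (x i).1 * (a - b) + (x i).2 (u - v)
            rw [map_sub]; ring
          rw [weightHom_single, weightHom_single, weightHom_single, weightHom_single,
            texp_add_eq_iff, texp_add_eq_iff, ← sub_nonpos, e, h _ (hS.sub_mem ha hb), ← e,
            sub_nonpos]
  ext f g
  change weightHom S w hw f = weightHom S w hw g ↔ weightHom S w' hw' f = weightHom S w' hw' g
  rw [MaxPlus.eq_iff_add_eq (x := weightHom S w hw f),
    MaxPlus.eq_iff_add_eq (x := weightHom S w' hw' f), key f g, key g f]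

/-- Each cone of the flag, starting from `{0}`, is a proper face of the next one for dimension
reasons, and relative interiors miss proper faces. -/
theorem ConeFlag.isAdapted_of_mem_intrinsicInterior {k : ℕ} (C : ConeFlag M k)
    {w : Fin (k + 1) → ℝ × NR M}
    (hw : ∀ i, w i ∈ intrinsicInterior ℝ (C.cone i : Set (ℝ × NR M))) : C.IsAdapted w where
  mem i := intrinsicInterior_subset (hw i)
  ne_zero h0 := by
    refine notMem_intrinsicInterior_of_isFaceOf (bot_isFaceOf (C.isCone 0).stronglyConvex)
      (fun h => ?_) (hw 0) h0
    have hd := C.dim 0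
    have : Submodule.span ℝ (C.cone 0 : Set (ℝ × NR M)) = ⊥ := by
      rw [Submodule.span_eq_bot]
      exact fun x hx => h hx
    unfold coneDim at hd
    rw [this, finrank_bot] at hd
    simp at hd
  notMem i := by
    refine notMem_intrinsicInterior_of_isFaceOf (C.face i) (fun h => ?_) (hw i.succ)
    have h1 := C.dim i.succ
    rw [le_antisymm h (C.face i).le, C.dim] at h1
    simp at h1

variable [Module.Finite ℤ M] [Module.Free ℤ M]

/-- The term `t^γ χ^u` of `S[M]` is at most `1` modulo `P_{C_•}`. -/
def ConeFlag.TermLeOne (S : Subsemiring (MaxPlus ℝ)) {k : ℕ} (C : ConeFlag M k) (γ : ℝ) (u : M) :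
    Prop :=
  ∃ hγ : texp γ ∈ S, C.primeCongruence S (AddMonoidAlgebra.single u ⟨texp γ, hγ⟩ + 1) 1

/-- The left side does not involve `w`: by independence of the choice, the sign test may be made
with whichever adapted family is convenient. -/
theorem ConeFlag.termLeOne_iff {S : Subsemiring (MaxPlus ℝ)} {k : ℕ} {C : ConeFlag M k}
    {w : Fin (k + 1) → ℝ × NR M} (h : C.IsAdapted w) {γ : ℝ} {u : M} :
    C.TermLeOne S γ u ↔ texp γ ∈ S ∧ toLex (fun i => termForm γ u (w i)) ≤ 0 := by
  unfold ConeFlag.TermLeOne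
  simp_rw [C.primeCongruence_eq S h, weightCongruence_single_add_one h.nonneg]
  exact exists_prop

theorem ConeFlag.primeCongruence_eq_iff {S : Subsemiring (MaxPlus ℝ)} (hS : IsSubsemifield S)
    {k k' : ℕ} (C : ConeFlag M k) (C' : ConeFlag M k') :
    C.primeCongruence S = C'.primeCongruence S ↔
      ∀ γ, texp γ ∈ S → ∀ u : M, C.TermLeOne S γ u ↔ C'.TermLeOne S γ u := by
  constructor
  · intro h γ _ u
    unfold ConeFlag.TermLeOne
    rw [h]
  · intro h
    obtain ⟨w, hw⟩ := C.exists_isAdapted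
    obtain ⟨w', hw'⟩ := C'.exists_isAdapted
    rw [C.primeCongruence_eq S hw, C'.primeCongruence_eq S hw']
    refine weightCongruence_eq_of_forall_term hS _ _ fun γ hγ u => ?_
    have := h γ hγ u
    rwa [ConeFlag.termLeOne_iff hw, ConeFlag.termLeOne_iff hw', and_iff_right hγ,
      and_iff_right hγ] at this

/-- Finitely many terms are at most `1` modulo `P_{C_•}` if and only if the intersection of the
corresponding half-spaces meets every set `R_i`. This applies to families of sets
`R_i ⊆ C_i \ C_{i-1}` that behave like the relative interiors of the cones `C_i`. -/
theorem ConeFlag.forall_exists_iff_forall_termLeOne {S : Subsemiring (MaxPlus ℝ)} {k : ℕ}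
    (C : ConeFlag M k) {R : Fin (k + 1) → Set (ℝ × NR M)} (hne : ∀ i, (R i).Nonempty)
    (hadapted : ∀ w : Fin (k + 1) → ℝ × NR M, (∀ i, w i ∈ R i) → C.IsAdapted w)
    (hcombo : ∀ (i : Fin k), ∀ p ∈ R i.castSucc, ∀ w ∈ R i.succ, ∀ ε : ℝ, 0 < ε → ε < 1 →
      (1 - ε) • p + ε • w ∈ R i.succ)
    {q : ℕ} (u : Fin q → M) (γ : Fin q → ℝ) (hγ : ∀ a, texp (γ a) ∈ S) :
    (∀ i, ∃ p ∈ R i, ∀ a, termForm (γ a) (u a) p ≤ 0) ↔ ∀ a, C.TermLeOne S (γ a) (u a) := by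
  constructor
  · intro h a
    choose p hp hle using h
    -- The test points themselves serve as the adapted family.
    rw [ConeFlag.termLeOne_iff (hadapted p hp)]
    exact ⟨hγ a, toLex_nonpos_of_forall fun i => hle i a⟩
  · intro h
    choose w hw using hne
    refine exists_mem_forall_nonpos hw (fun i p hp => hcombo i p hp _ (hw i.succ)) _ fun a => ?_
    exact ((ConeFlag.termLeOne_iff (hadapted w hw)).1 (h a)).2

/-! ### Neighborhoods of flags of cones -/

theorem ConeFlag.isAdmissibleNhd_iff {S : Subsemiring (MaxPlus ℝ)} {k : ℕ} (C : ConeFlag M k)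
    {q : ℕ} (u : Fin q → M) (γ : Fin q → ℝ) (hγ : ∀ a, γ a ∈ valueGroup S) :
    C.IsAdmissibleNhd (valueGroup S) {w | 0 ≤ w.1 ∧ ∀ a, w.1 * γ a + w.2 (u a) ≤ 0} ↔
      ∀ a, C.TermLeOne S (γ a) (u a) := by
  have hconv : ∀ i, Convex ℝ (C.cone i : Set (ℝ × NR M)) := fun i => (C.cone i).convex
  rw [← C.forall_exists_iff_forall_termLeOne
    (R := fun i => intrinsicInterior ℝ (C.cone i : Set (ℝ × NR M)))
    (fun i => intrinsicInterior_nonempty_of_convex (hconv i) ⟨0, (C.cone i).zero_mem⟩)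
    (fun w hw => C.isAdapted_of_mem_intrinsicInterior hw)
    (fun i p hp w hw ε h0 h1 => combo_mem_intrinsicInterior (hconv i.succ)
      ((C.face i).le (intrinsicInterior_subset hp)) hw h0 h1) u γ hγ]
  constructor
  · rintro ⟨-, h⟩ i
    obtain ⟨p, hp, hpi⟩ := h i
    exact ⟨p, hpi, hp.2⟩
  · refine fun h => ⟨⟨q, u, γ, hγ, rfl⟩, fun i => ?_⟩
    obtain ⟨p, hpi, hp⟩ := h i
    -- The condition `r ≥ 0` in an admissible cone is automatic on the cones of the flag.
    exact ⟨p, ⟨C.nonneg i p (intrinsicInterior_subset hpi), hp⟩, hpi⟩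

theorem ConeFlag.primeCongruence_eq_iff_locallyEquivalent {S : Subsemiring (MaxPlus ℝ)}
    (hS : IsSubsemifield S) {k k' : ℕ} (C : ConeFlag M k) (C' : ConeFlag M k') :
    C.primeCongruence S = C'.primeCongruence S ↔ C.LocallyEquivalent (valueGroup S) C' := by
  rw [C.primeCongruence_eq_iff hS C']
  constructor
  · intro h D
    by_cases hD : IsAdmissibleCone (valueGroup S) D
    · obtain ⟨q, u, γ, hγ, rfl⟩ := hD
      rw [C.isAdmissibleNhd_iff u γ hγ, C'.isAdmissibleNhd_iff u γ hγ]
      exact forall_congr' fun a => h _ (hγ a) _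
    · exact iff_of_false (fun h => hD h.1) fun h => hD h.1
  · intro h γ hγ u
    -- An admissible cone with a single inequality isolates a single term.
    have := h {w | 0 ≤ w.1 ∧ ∀ _ : Fin 1, w.1 * γ + w.2 u ≤ 0}
    rw [C.isAdmissibleNhd_iff (fun _ => u) (fun _ => γ) fun _ => hγ,
      C'.isAdmissibleNhd_iff (fun _ => u) (fun _ => γ) fun _ => hγ] at this
    simpa using this

/-! ### Neighborhoods of flags of polyhedra -/

theorem IsStronglyConvexPolyhedron.convex {V : Type*} [AddCommGroup V] [Module ℝ V] {P : Set V}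
    (hP : IsStronglyConvexPolyhedron P) : Convex ℝ P := by
  obtain ⟨s, rfl⟩ := hP.polyhedral
  intro x hx y hy a b ha hb hab h hh
  rw [map_add, map_smul, map_smul, smul_eq_mul, smul_eq_mul]
  calc a * h.1 x + b * h.1 y ≤ a * h.2 + b * h.2 :=
        add_le_add (mul_le_mul_of_nonneg_left (hx h hh) ha) (mul_le_mul_of_nonneg_left (hy h hh) hb)
    _ = h.2 := by rw [← add_mul, hab, one_mul]

/-- Taking the closure adds nothing at height `1`: there the homogenized inequalities are again
those of `P`. -/
theorem mk_one_mem_coneOver_iff {P : Set (NR M)} (hP : IsStronglyConvexPolyhedron P) {x : NR M} :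
    ((1 : ℝ), x) ∈ coneOver P ↔ x ∈ P := by
  refine ⟨fun h => ?_, mk_one_mem_coneOver⟩
  obtain ⟨s, hs⟩ := hP.polyhedral
  rw [mem_coneOver_iff (s := (s : Set (Module.Dual ℝ (NR M) × ℝ))) hs hP.nonempty] at h
  rw [hs]
  intro a ha
  have := h.2 a ha
  rw [homogenize_apply] at this
  simpa using this

/-- The prolongation argument is repeated at height `1`, so relative interiors of `P_i` and of
`c(P_i)` need not be compared. If `(1, x_{i+1})` lay in the face `c(P_i)`, then so would `(1, y)`
for every `y ∈ P_{i+1}`, giving `P_{i+1} = P_i` against the dimensions. -/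
theorem PolyFlag.isAdapted_of_mem_intrinsicInterior {k : ℕ} (P : PolyFlag M k)
    {x : Fin (k + 1) → NR M} (hx : ∀ i, x i ∈ intrinsicInterior ℝ (P.poly i)) :
    P.coneFlag.IsAdapted fun i => ((1 : ℝ), x i) where
  mem i := mk_one_mem_coneOver (intrinsicInterior_subset (hx i))
  ne_zero h := one_ne_zero (congrArg Prod.fst h)
  notMem i hF := by
    have hsub : P.poly i.succ ⊆ P.poly i.castSucc := by
      intro y hy
      obtain ⟨t, ht, h⟩ := exists_add_smul_sub_mem_of_mem_intrinsicInterior (hx i.succ) hy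
      refine (mk_one_mem_coneOver_iff (P.isPolyhedron i.castSucc)).1 ?_
      refine (P.coneFlag.face i).mem_of_smul_add_mem (mk_one_mem_coneOver hy)
        (mk_one_mem_coneOver h) ht ?_
      have e : t • ((1 : ℝ), y) + ((1 : ℝ), x i.succ + t • (x i.succ - y)) =
          (1 + t) • ((1 : ℝ), x i.succ) := by
        refine Prod.ext ?_ ?_
        · simp [add_comm]
        · change t • y + (x i.succ + t • (x i.succ - y)) = (1 + t) • x i.succ
          module
      rw [e]
      exact (P.coneFlag.cone i.castSucc).smul_mem (add_nonneg zero_le_one ht.le) hF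
    have h1 := P.dim i.succ
    rw [hsub.antisymm (P.face i).subset, P.dim] at h1
    simp at h1

/-- The sign changes because `⟨x, u⟩ ≤ γ` is nonpositivity of the form `⟨·, (-γ, u)⟩` at `(1, x)`.
Convex combinations stay at height `1`, so the sets `{1} × relint P_i` can play the role of the `R
i`. -/
theorem PolyFlag.isRationalNhd_iff {S : Subsemiring (MaxPlus ℝ)} {k : ℕ} (P : PolyFlag M k)
    {q : ℕ} (u : Fin q → M) (γ : Fin q → ℝ) (hγ : ∀ a, γ a ∈ valueGroup S)
    (hγ' : ∀ a, -γ a ∈ valueGroup S) :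
    P.IsRationalNhd (valueGroup S) {x | ∀ a, x (u a) ≤ γ a} ↔
      ∀ a, P.coneFlag.TermLeOne S (-γ a) (u a) := by
  have hconv : ∀ i, Convex ℝ (P.poly i) := fun i => (P.isPolyhedron i).convex
  rw [← P.coneFlag.forall_exists_iff_forall_termLeOne
    (R := fun i => (fun x => ((1 : ℝ), x)) '' intrinsicInterior ℝ (P.poly i))
    (fun i => (intrinsicInterior_nonempty_of_convex (hconv i) (P.isPolyhedron i).nonempty).image _)
    (fun w hw => by
      choose x hx hxw using hw
      have := P.isAdapted_of_mem_intrinsicInterior hx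
      rwa [show (fun i => ((1 : ℝ), x i)) = w from funext hxw] at this)
    (fun i p hp w hw ε h0 h1 => by
      obtain ⟨x, hx, rfl⟩ := hp
      obtain ⟨y, hy, rfl⟩ := hw
      refine ⟨_, combo_mem_intrinsicInterior (hconv i.succ)
        ((P.face i).subset (intrinsicInterior_subset hx)) hy h0 h1, ?_⟩
      refine Prod.ext ?_ rfl
      simp) u (fun a => -γ a) hγ']
  have e : ∀ (x : NR M) a, termForm (-γ a) (u a) ((1 : ℝ), x) ≤ 0 ↔ x (u a) ≤ γ a := by
    intro x a
    rw [termForm_apply, one_mul, neg_add_nonpos_iff]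
  constructor
  · rintro ⟨-, h⟩ i
    obtain ⟨x, hx, hxi⟩ := h i
    exact ⟨_, ⟨x, hxi, rfl⟩, fun a => (e x a).2 (hx a)⟩
  · refine fun h => ⟨⟨q, u, γ, hγ, rfl⟩, fun i => ?_⟩
    obtain ⟨_, ⟨x, hxi, rfl⟩, hx⟩ := h i
    exact ⟨x, fun a => (e x a).1 (hx a), hxi⟩

theorem PolyFlag.primeCongruence_eq_iff_locallyEquivalent {S : Subsemiring (MaxPlus ℝ)}
    (hS : IsSubsemifield S) {k k' : ℕ} (P : PolyFlag M k) (P' : PolyFlag M k') :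
    P.primeCongruence S = P'.primeCongruence S ↔ P.LocallyEquivalent (valueGroup S) P' := by
  have hneg : ∀ γ ∈ valueGroup S, -γ ∈ valueGroup S := fun γ hγ => by
    have := hS.sub_mem (a := 0) (by rw [texp_zero]; exact S.one_mem) hγ
    rwa [zero_sub] at this
  unfold PolyFlag.primeCongruence
  rw [P.coneFlag.primeCongruence_eq_iff hS P'.coneFlag]
  constructor
  · intro h Q
    by_cases hQ : IsRationalPolyhedron (valueGroup S) Q
    · obtain ⟨q, u, γ, hγ, rfl⟩ := hQ
      have hγ' := fun a => hneg _ (hγ a)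
      rw [P.isRationalNhd_iff u γ hγ hγ', P'.isRationalNhd_iff u γ hγ hγ']
      exact forall_congr' fun a => h _ (hγ' a) _
    · exact iff_of_false (fun h => hQ h.1) fun h => hQ h.1
  · intro h γ hγ u
    have hγ' : - -γ ∈ valueGroup S := by rwa [neg_neg]
    -- The bound is `-γ` so that the corresponding term is `t^γ χ^u`.
    have := h {x | ∀ _ : Fin 1, x u ≤ -γ}
    rw [P.isRationalNhd_iff (fun _ => u) (fun _ => -γ) (fun _ => hneg γ hγ) fun _ => hγ',
      P'.isRationalNhd_iff (fun _ => u) (fun _ => -γ) (fun _ => hneg γ hγ) fun _ => hγ'] at this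
    simpa using this

end Flags

end FlagPrime

theorem mainTheorem7 {M : Type*} [AddCommGroup M] [Module.Finite ℤ M] [Module.Free ℤ M]
    (S : Subsemiring (FlagPrime.MaxPlus ℝ)) (hS : FlagPrime.IsSubsemifield S) :
    (∀ (k k' : ℕ) (C : FlagPrime.ConeFlag M k) (C' : FlagPrime.ConeFlag M k'),
      C.IsSimplicial → C'.IsSimplicial →
        (C.primeCongruence S = C'.primeCongruence S ↔
          C.LocallyEquivalent (FlagPrime.valueGroup S) C')) ∧
    (∀ (k k' : ℕ) (P : FlagPrime.PolyFlag M k) (P' : FlagPrime.PolyFlag M k'),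
      (P.primeCongruence S = P'.primeCongruence S ↔
        P.LocallyEquivalent (FlagPrime.valueGroup S) P')) :=
  ⟨fun _ _ C C' _ _ => C.primeCongruence_eq_iff_locallyEquivalent hS C',
    fun _ _ P P' => P.primeCongruence_eq_iff_locallyEquivalent hS P'⟩
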